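/- **Setting.** Let $\Omega\subseteq\mathbb{R}^n$ be a domain (open and connected), let $S(m)$ be the space of real symmetric $m\times m$ matrices with the norm $\lVert X\rVert=\sqrt{\operatorname{tr}(X^TX)}$, and let $H\colon\Omega\to S(m)$. Let $\lambda_1(x)\le\cdots\le\lambda_m(x)$ be the eigenvalues of $H(x)$ repeated according to multiplicity, $P_i(x)$ the matrix of the orthogonal projection onto the eigenspace of $\lambda_i(x)$, $d_i(x)=\operatorname{tr}P_i(x)$, so that $H(x)=\sum_{i=1}^m\frac{\lambda_i(x)}{d_i(x)}P_i(x)$, and $$A_j(x)=\sum_{i:\ \lambda_i(x)\ne\lambda_j(x)}\frac{P_i(x)/d_i(x)}{\lambda_j(x)-\lambda_i(x)}.$$ For a function $F$ on $\Omega$ write $D_eF(x)=\lim_{h\to0}\frac{F(x+he)-F(x)}{h}$ (two-sided limit) for the directional derivative. $\nabla f$ denotes the Jacobian matrix of a vector-valued function $f$ (so gradients are row vectors), and for a matrix-valued $F$ and a fixed vector $q$, $\nabla_qF(x)$ denotes the Jacobian matrix of $y\mapsto F(y)q$ at $x$. **Theorem.** Let $j\in\{1,\dots,m\}$. (A) Assume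 that $H$ is continuous in $\Omega$. (i) $\lambda_j$ is continuous in $\Omega$. (ii) If $0<\alpha\le1$ and $\lVert H(x)-H(y)\rVert\le C|x-y|^\alpha$ for all $x,y\in\Omega$, then $|\lambda_j(x)-\lambda_j(y)|\le C|x-y|^\alpha$ for all $x,y\in\Omega$. (B) Assume that $H\in C^1(\Omega,S(m))$. (i) If $\operatorname{tr}P_j(x)=d_j$ is constant in $\Omega$, then for all $x\in\Omega$ and $e\in\mathbb{R}^n$ the directional derivative $D_e\lambda_j(x)$ exists and $$D_e\lambda_j(x)\,P_j(x)=P_j(x)\,D_eH(x)\,P_j(x),\qquad D_e\lambda_j(x)=\tfrac1{d_j}\operatorname{tr}\big(P_j(x)D_eH(x)\big),$$ $$D_e\lambda_j(x)=\xi^TD_eH(x)\,\xi=\xi^T\nabla_\xi H(x)\,e\quad\text{for every unit vector }\xi\in P_j(x)(\mathbb{R}^m).$$ (ii) The following conditions in $\Omega$ are equivalent: (a) $\lambda_j$ is $C^1$ and $\operatorname{tr}P_j$ is constant; (b) $\lambda_j$ is differentiable and $\operatorname{tr}P_j$ is constant; (c) $P_j$ is differentiable; (d) $P_j$ is continuous.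 If one of them holds, then for every $x\in\Omega$ the function $\lambda_j$ is differentiable at $x$, $$|\nabla\lambda_j(x)|\le\frac1{\sqrt{d_j(x)}}\max_{|e|=1}\lVert D_eH(x)\rVert,\qquad \nabla\lambda_j(x)=\xi^T\nabla_\xi H(x)\quad\text{for every unit vector }\xi\in P_j(x)(\mathbb{R}^m),$$ and $\nabla\lambda_j(x)e=D_e\lambda_j(x)=\frac1{d_j(x)}\operatorname{tr}\big(P_j(x)D_eH(x)\big)$ for every $e\in\mathbb{R}^n$. (For $n=0$ the maximum is read as $0$.) (C) Assume that $H\in C^2(\Omega,S(m))$. (i) Let $a\in\mathbb{R}^n$. If $\operatorname{tr}P_j(x)=d_j$ is constant in $\Omega$, then $D_a\lambda_j$ exists in $\Omega$ and, for all $x\in\Omega$ and $b\in\mathbb{R}^n$, $D_bD_a\lambda_j(x)$ exists and (everything evaluated at $x$) $$D_bD_a\lambda_j\,P_j=P_j\big(D_bD_aH+D_aH\,A_j\,D_bH+D_bH\,A_j\,D_aH\big)P_j,$$ $$D_bD_a\lambda_j=\tfrac1{d_j}\operatorname{tr}\big(P_j[D_bD_aH+2D_aH\,A_j\,D_bH]\big),$$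 $$D_bD_a\lambda_j=\xi^T\big(D_bD_aH+2D_aH\,A_j\,D_bH\big)\xi=a^T\big(\nabla_\xi(\nabla_\xi H)^T+2(\nabla_\xi H)^TA_j\nabla_\xi H\big)b$$ for every unit vector $\xi\in P_j(x)(\mathbb{R}^m)$. (ii) If one of the conditions (a)–(d) of (B)(ii) holds, then $\lambda_j$ is differentiable in $\Omega$ and its gradient $\nabla\lambda_j$ is differentiable in $\Omega$, and for every $x\in\Omega$ the Hessian $\mathcal{H}\lambda_j=\nabla(\nabla\lambda_j^T)$ satisfies $$\mathcal{H}\lambda_j(x)=\nabla_\xi(\nabla_\xi H)^T(x)+2(\nabla_\xi H(x))^TA_j(x)\nabla_\xi H(x)$$ for every unit vector $\xi\in P_j(x)(\mathbb{R}^m)$, and, for all $a,b\in\mathbb{R}^n$, $$a^T\mathcal{H}\lambda_j(x)b=D_bD_a\lambda_j(x)=\tfrac1{d_j(x)}\operatorname{tr}\big(P_j(x)[D_bD_aH(x)+2D_aH(x)A_j(x)D_bH(x)]\big).$$ -/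

import Mathlib

open scoped Matrix Matrix.Norms.Frobenius NNReal

namespace EigReg

noncomputable section

/-- The `j`-th eigenvalue of a symmetric real matrix `X`, in nondecreasing order and repeated
according to multiplicity (Mathlib's `eigenvalues₀` is nonincreasing, hence the reversal of the
index). The value is `0` for a matrix that is not symmetric. -/
def eigval {m : ℕ} (X : Matrix (Fin m) (Fin m) ℝ) (j : Fin m) : ℝ :=
  open Classical in
  if h : X.IsHermitian then h.eigenvalues₀ (Fin.cast (Fintype.card_fin m).symm j.rev) else 0

/-- The eigenspace `{ξ | X ξ = λ_j ξ}` of the `j`-th eigenvalue of `X`. -/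
def eigspace {m : ℕ} (X : Matrix (Fin m) (Fin m) ℝ) (j : Fin m) :
    Submodule ℝ (EuclideanSpace ℝ (Fin m)) :=
  Module.End.eigenspace (Matrix.toEuclideanLin X) (eigval X j)

/-- The eigenprojection `P_j`: the matrix of the orthogonal projection onto the eigenspace of the
`j`-th eigenvalue of `X`. -/
def eigproj {m : ℕ} (X : Matrix (Fin m) (Fin m) ℝ) (j : Fin m) : Matrix (Fin m) (Fin m) ℝ :=
  (Matrix.toEuclideanCLM (n := Fin m) (𝕜 := ℝ)).symm (eigspace X j).starProjection

/-- `A_j = ∑_{i : λ_i ≠ λ_j} (P_i / d_i) / (λ_j - λ_i)` with `d_i = tr P_i`, the pseudoinverse of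
`λ_j I - X`. -/
def pinv {m : ℕ} (X : Matrix (Fin m) (Fin m) ℝ) (j : Fin m) : Matrix (Fin m) (Fin m) ℝ :=
  open Classical in
  ∑ i ∈ Finset.univ.filter (fun i => eigval X i ≠ eigval X j),
    (eigval X j - eigval X i)⁻¹ • ((eigproj X i).trace⁻¹ • eigproj X i)

/-- The set `P(ℝ^m) ∩ S^{m-1}` of unit vectors in the range of `P`. -/
def unitRange {m : ℕ} (P : Matrix (Fin m) (Fin m) ℝ) : Set (Fin m → ℝ) :=
  {ξ | (∃ η : Fin m → ℝ, P *ᵥ η = ξ) ∧ ξ ⬝ᵥ ξ = 1}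

/-- The Jacobian matrix `∇f(x) ∈ ℝ^{k×n}` of a vector valued function on `ℝ^n`. -/
def jacobian {n k : ℕ} (f : EuclideanSpace ℝ (Fin n) → EuclideanSpace ℝ (Fin k))
    (x : EuclideanSpace ℝ (Fin n)) : Matrix (Fin k) (Fin n) ℝ :=
  Matrix.of fun i l => (fderiv ℝ f x (EuclideanSpace.single l 1)) i

/-- The Jacobian derivative `∇_q F(x) = ∇[F q](x) ∈ ℝ^{m×n}` of a matrix valued function
`F : ℝ^n → ℝ^{m×k}` for a fixed `q ∈ ℝ^k`. -/
def jacDeriv {n m k : ℕ} (q : Fin k → ℝ) (F : EuclideanSpace ℝ (Fin n) → Matrix (Fin m) (Fin k) ℝ)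
    (x : EuclideanSpace ℝ (Fin n)) : Matrix (Fin m) (Fin n) ℝ :=
  jacobian (fun y => WithLp.toLp 2 (F y *ᵥ q)) x

/-- The (two-sided) directional derivative `D_e F(x) = lim_{h → 0} (F(x + h e) - F(x)) / h` of a
matrix valued function. -/
abbrev dirD {n m k : ℕ} (e : EuclideanSpace ℝ (Fin n))
    (F : EuclideanSpace ℝ (Fin n) → Matrix (Fin m) (Fin k) ℝ)
    (x : EuclideanSpace ℝ (Fin n)) : Matrix (Fin m) (Fin k) ℝ :=
  lineDeriv ℝ F x e

/-- The second order term `∇_ξ(∇_ξ H)ᵀ(x) + 2 (∇_ξ H(x))ᵀ A_j(x) ∇_ξ H(x) ∈ ℝ^{n×n}`. -/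
def hessForm {n m : ℕ} (H : EuclideanSpace ℝ (Fin n) → Matrix (Fin m) (Fin m) ℝ) (j : Fin m)
    (ξ : Fin m → ℝ) (x : EuclideanSpace ℝ (Fin n)) : Matrix (Fin n) (Fin n) ℝ :=
  jacDeriv ξ (fun y => (jacDeriv ξ H y)ᵀ) x
    + (2 : ℝ) • ((jacDeriv ξ H x)ᵀ * pinv (H x) j * jacDeriv ξ H x)

/-- The four conditions on the `j`-th eigenvalue `λ_j` and eigenprojection `P_j` of `H` in `Ω`:
(a) `λ_j` is `C¹` and `P_j` has constant dimension, (b) `λ_j` is differentiable and `P_j` has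
constant dimension, (c) `P_j` is differentiable, (d) `P_j` is continuous. -/
def regConds {n m : ℕ} (Ω : Set (EuclideanSpace ℝ (Fin n)))
    (H : EuclideanSpace ℝ (Fin n) → Matrix (Fin m) (Fin m) ℝ) (j : Fin m) : List Prop :=
  [ContDiffOn ℝ 1 (fun y => eigval (H y) j) Ω ∧ ∃ d : ℝ, ∀ y ∈ Ω, (eigproj (H y) j).trace = d,
   DifferentiableOn ℝ (fun y => eigval (H y) j) Ω ∧
    ∃ d : ℝ, ∀ y ∈ Ω, (eigproj (H y) j).trace = d,
   DifferentiableOn ℝ (fun y => eigproj (H y) j) Ω,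
   ContinuousOn (fun y => eigproj (H y) j) Ω]

end

end EigReg

open EigReg

/-!
Weyl's inequality makes `λ_j` Lipschitz in the matrix, which gives (A).

Where `tr P_j` is constant, `A_j (λ_j I - H) = I - P_j` shows that `P_j` is as regular at a point
as `H` is: the increment of `P_j` is bounded by that of `H`. Multiplying
`(H(y) - λ_j(y) I) P_j(y) = 0` by `P_j(x)` then gives `D_eλ_j P_j = P_j D_eH P_j`, multiplying it by
`A_j(x)` gives `(I - P_j) D_eP_j = A_j D_eH P_j`, and as `P_j` is a projection this determines
`D_eP_j = A_j D_eH P_j + P_j D_eH A_j`. The second order formulas come from differentiating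
`D_aλ_j P_j = P_j D_aH P_j` once more. Traces and unit vectors in the range of `P_j` turn the matrix
identities into scalar ones. Finally, if `P_j` is continuous, then `tr P_j` is continuous and
integer valued, hence constant on the connected set `Ω`.
-/

namespace EigReg

open scoped RealInnerProductSpace Topology

section Spectral

variable {m : ℕ} {X : Matrix (Fin m) (Fin m) ℝ}

/-- An orthonormal basis of eigenvectors of a symmetric matrix `X`, ordered like `eigval X`. -/
noncomputable def eigvecBasis (hX : X.IsSymm) :
    OrthonormalBasis (Fin m) ℝ (EuclideanSpace ℝ (Fin m)) :=
  (Matrix.isHermitian_iff_isSymm.2 hX).eigenvectorBasis.reindex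
    ((Fintype.equivOfCardEq (Fintype.card_fin _)).symm.trans
      ((finCongr (Fintype.card_fin m)).trans Fin.revPerm))

theorem mulVec_eigvecBasis (hX : X.IsSymm) (k : Fin m) :
    X *ᵥ (eigvecBasis hX k).ofLp = eigval X k • (eigvecBasis hX k).ofLp := by
  have hX' := Matrix.isHermitian_iff_isSymm.2 hX
  rw [eigvecBasis, OrthonormalBasis.reindex_apply, hX'.mulVec_eigenvectorBasis,
    Matrix.IsHermitian.eigenvalues, eigval, dif_pos hX']
  simp

theorem monotone_eigval (hX : X.IsSymm) : Monotone (eigval X) := by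
  intro i k hik
  simp only [eigval, Matrix.isHermitian_iff_isSymm.2 hX, dif_pos]
  exact Matrix.IsHermitian.eigenvalues₀_antitone _ (by simpa using hik)

theorem eq_of_mulVec_basis_eq {ι n : Type*} [Fintype ι] [Fintype n]
    (b : OrthonormalBasis ι ℝ (EuclideanSpace ℝ n)) {M N : Matrix n n ℝ}
    (h : ∀ k, M *ᵥ (b k).ofLp = N *ᵥ (b k).ofLp) : M = N := by
  classical
  refine Matrix.toEuclideanLin.injective <| b.toBasis.ext fun k => ?_
  simp [Matrix.toLpLin_apply, h k]

theorem eigproj_mulVec (X : Matrix (Fin m) (Fin m) ℝ) (j : Fin m)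
    (u : EuclideanSpace ℝ (Fin m)) :
    eigproj X j *ᵥ u.ofLp = ((eigspace X j).starProjection u).ofLp := by
  rw [← Matrix.ofLp_toEuclideanCLM, eigproj, StarAlgEquiv.apply_symm_apply]

theorem mem_eigspace_iff {j : Fin m} {u : EuclideanSpace ℝ (Fin m)} :
    u ∈ eigspace X j ↔ X *ᵥ u.ofLp = eigval X j • u.ofLp :=
  Module.End.mem_eigenspace_iff.trans (WithLp.ofLp_injective 2).eq_iff.symm

theorem eigproj_mulVec_eigvecBasis (hX : X.IsSymm) (j k : Fin m) :
    eigproj X j *ᵥ (eigvecBasis hX k).ofLp =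
      if eigval X k = eigval X j then (eigvecBasis hX k).ofLp else 0 := by
  rw [eigproj_mulVec]
  split_ifs with hkj
  · congr 1
    rw [Submodule.starProjection_eq_self_iff, mem_eigspace_iff, mulVec_eigvecBasis, hkj]
  · suffices eigvecBasis hX k ∈ (eigspace X j)ᗮ by
      rw [(Submodule.starProjection_apply_eq_zero_iff _).2 this, WithLp.ofLp_zero]
    have hsymm := Matrix.isSymmetric_toEuclideanLin_iff.2 (Matrix.isHermitian_iff_isSymm.2 hX)
    have hk : eigvecBasis hX k ∈ eigspace X k := mem_eigspace_iff.2 (mulVec_eigvecBasis hX k)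
    exact (Submodule.mem_orthogonal _ _).2 fun w hw =>
      hsymm.orthogonalFamily_eigenspaces.pairwise hkj hk w hw

theorem isStarProjection_eigproj (X : Matrix (Fin m) (Fin m) ℝ) (j : Fin m) :
    IsStarProjection (eigproj X j) where
  isIdempotentElem := isStarProjection_starProjection.isIdempotentElem.map
    (Matrix.toEuclideanCLM (n := Fin m) (𝕜 := ℝ)).symm
  isSelfAdjoint := (map_star (Matrix.toEuclideanCLM (n := Fin m) (𝕜 := ℝ)).symm _).symm.trans
    (congrArg _ isStarProjection_starProjection.isSelfAdjoint)

theorem isSymm_eigproj (X : Matrix (Fin m) (Fin m) ℝ) (j : Fin m) : (eigproj X j).IsSymm :=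
  Matrix.isHermitian_iff_isSymm.1 (isStarProjection_eigproj X j).isSelfAdjoint

theorem eigproj_mul_self (X : Matrix (Fin m) (Fin m) ℝ) (j : Fin m) :
    eigproj X j * eigproj X j = eigproj X j :=
  (isStarProjection_eigproj X j).isIdempotentElem

theorem mul_eigproj (X : Matrix (Fin m) (Fin m) ℝ) (j : Fin m) :
    X * eigproj X j = eigval X j • eigproj X j := by
  refine eq_of_mulVec_basis_eq (EuclideanSpace.basisFun _ _) fun k => ?_
  rw [← Matrix.mulVec_mulVec, Matrix.smul_mulVec, eigproj_mulVec]
  exact mem_eigspace_iff.1 (Submodule.starProjection_apply_mem _ _)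

theorem eigproj_mul (hX : X.IsSymm) (j : Fin m) :
    eigproj X j * X = eigval X j • eigproj X j := by
  simpa only [Matrix.transpose_mul, Matrix.transpose_smul, (isSymm_eigproj X j).eq, hX.eq]
    using congrArg Matrix.transpose (mul_eigproj X j)

theorem trace_eq_sum_dotProduct_mulVec {ι n : Type*} [Fintype ι] [Fintype n]
    (b : OrthonormalBasis ι ℝ (EuclideanSpace ℝ n)) (M : Matrix n n ℝ) :
    M.trace = ∑ k, (b k).ofLp ⬝ᵥ (M *ᵥ (b k).ofLp) := by
  classical
  simp only [← Matrix.inner_toEuclideanCLM]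
  rw [← Matrix.trace_toLin_eq M (EuclideanSpace.basisFun n ℝ).toBasis]
  exact LinearMap.trace_eq_sum_inner _ b

theorem dotProduct_self_of_orthonormal {ι n : Type*} [Fintype n] {v : ι → EuclideanSpace ℝ n}
    (hv : Orthonormal ℝ v) (k : ι) : (v k).ofLp ⬝ᵥ (v k).ofLp = 1 := by
  simpa only [EuclideanSpace.inner_eq_star_dotProduct, star_trivial] using
    inner_self_eq_one_of_norm_eq_one (𝕜 := ℝ) (hv.1 k)

theorem trace_eigproj (hX : X.IsSymm) (j : Fin m) :
    (eigproj X j).trace = (Finset.univ.filter fun k => eigval X k = eigval X j).card := by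
  simp only [trace_eq_sum_dotProduct_mulVec (eigvecBasis hX), eigproj_mulVec_eigvecBasis,
    apply_ite (dotProduct _), dotProduct_zero,
    dotProduct_self_of_orthonormal (eigvecBasis hX).orthonormal, Finset.sum_boole]

theorem trace_eigproj_pos (hX : X.IsSymm) (j : Fin m) : 0 < (eigproj X j).trace := by
  rw [trace_eigproj hX, Nat.cast_pos, Finset.card_pos]
  exact ⟨j, by simp⟩

-- The restriction `λ_i ≠ λ_j` in the definition may be dropped because `0⁻¹ = 0`.
theorem pinv_eq_sum (X : Matrix (Fin m) (Fin m) ℝ) (j : Fin m) :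
    pinv X j = ∑ i, (eigval X j - eigval X i)⁻¹ • (eigproj X i).trace⁻¹ • eigproj X i := by
  refine Finset.sum_filter_of_ne fun i _ hi hij => hi ?_
  rw [hij, sub_self, inv_zero, zero_smul]

theorem pinv_mulVec_eigvecBasis (hX : X.IsSymm) (j k : Fin m) :
    pinv X j *ᵥ (eigvecBasis hX k).ofLp =
      (eigval X j - eigval X k)⁻¹ • (eigvecBasis hX k).ofLp := by
  have hterm (i : Fin m) :
      ((eigval X j - eigval X i)⁻¹ • (eigproj X i).trace⁻¹ • eigproj X i) *ᵥ
        (eigvecBasis hX k).ofLp =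
      if eigval X i = eigval X k then
        (eigproj X k).trace⁻¹ • (eigval X j - eigval X k)⁻¹ • (eigvecBasis hX k).ofLp else 0 := by
    rw [Matrix.smul_mulVec, Matrix.smul_mulVec, eigproj_mulVec_eigvecBasis, trace_eigproj hX,
      trace_eigproj hX, smul_comm]
    obtain hik | hik := eq_or_ne (eigval X i) (eigval X k)
    · simp only [hik, if_true]
    · simp only [hik, hik.symm, if_false, smul_zero]
  rw [pinv_eq_sum, Matrix.sum_mulVec, Finset.sum_congr rfl fun i _ => hterm i, ← Finset.sum_filter,
    Finset.sum_const, ← Nat.cast_smul_eq_nsmul ℝ, ← trace_eigproj hX,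
    smul_inv_smul₀ (trace_eigproj_pos hX k).ne']

theorem isSymm_pinv (X : Matrix (Fin m) (Fin m) ℝ) (j : Fin m) : (pinv X j).IsSymm := by
  simp only [Matrix.IsSymm, pinv, Matrix.transpose_sum, Matrix.transpose_smul,
    (isSymm_eigproj X _).eq]

theorem pinv_mul_eigproj (hX : X.IsSymm) (j : Fin m) : pinv X j * eigproj X j = 0 := by
  refine eq_of_mulVec_basis_eq (eigvecBasis hX) fun k => ?_
  rw [← Matrix.mulVec_mulVec, eigproj_mulVec_eigvecBasis, Matrix.zero_mulVec]
  split_ifs with hkj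
  · rw [pinv_mulVec_eigvecBasis, hkj, sub_self, inv_zero, zero_smul]
  · rw [Matrix.mulVec_zero]

theorem eigproj_mul_pinv (hX : X.IsSymm) (j : Fin m) : eigproj X j * pinv X j = 0 := by
  simpa only [Matrix.transpose_mul, (isSymm_eigproj X j).eq, (isSymm_pinv X j).eq,
    Matrix.transpose_zero] using congrArg Matrix.transpose (pinv_mul_eigproj hX j)

theorem pinv_mul_sub (hX : X.IsSymm) (j : Fin m) :
    pinv X j * (eigval X j • 1 - X) = 1 - eigproj X j := by
  refine eq_of_mulVec_basis_eq (eigvecBasis hX) fun k => ?_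
  simp only [← Matrix.mulVec_mulVec, Matrix.sub_mulVec, Matrix.smul_mulVec, Matrix.one_mulVec,
    mulVec_eigvecBasis, eigproj_mulVec_eigvecBasis, ← sub_smul, Matrix.mulVec_smul,
    pinv_mulVec_eigvecBasis, smul_smul]
  split_ifs with hkj
  · rw [hkj, sub_self, zero_mul, zero_smul, sub_self]
  · rw [mul_inv_cancel₀ (sub_ne_zero.2 (Ne.symm hkj)), one_smul, sub_zero]

end Spectral

section Frobenius

variable {k l : Type*} [Fintype k] [Fintype l]

theorem frobenius_norm_sq (M : Matrix k l ℝ) : ‖M‖ ^ 2 = (M * Mᵀ).trace := by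
  rw [Matrix.frobenius_norm_def, ← Real.sqrt_eq_rpow, Real.sq_sqrt (by positivity)]
  simp [Matrix.trace, Matrix.mul_apply, sq]

theorem abs_trace_mul_le (M : Matrix k l ℝ) (N : Matrix l k ℝ) :
    |(M * N).trace| ≤ ‖M‖ * ‖N‖ := by
  rw [← Matrix.frobenius_norm_transpose N]
  refine abs_le_of_sq_le_sq ?_ (by positivity)
  rw [mul_pow, frobenius_norm_sq, frobenius_norm_sq]
  simp only [Matrix.trace, Matrix.diag, Matrix.mul_apply, Matrix.transpose_apply, ← sq,
    ← Finset.sum_product']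
  exact Finset.sum_mul_sq_le_sq_mul_sq _ _ _

theorem dotProduct_mulVec_le (M : Matrix k k ℝ) (u : EuclideanSpace ℝ k) :
    u.ofLp ⬝ᵥ (M *ᵥ u.ofLp) ≤ ‖M‖ * ‖u‖ ^ 2 := by
  have hdot : u.ofLp ⬝ᵥ u.ofLp = ‖u‖ ^ 2 := by
    simp only [EuclideanSpace.real_norm_sq_eq, dotProduct, ← sq]
  have hnorm : ‖Matrix.vecMulVec u.ofLp u.ofLp‖ = ‖u‖ ^ 2 := by
    refine (sq_eq_sq₀ (norm_nonneg _) (sq_nonneg _)).1 ?_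
    rw [frobenius_norm_sq, Matrix.transpose_vecMulVec, Matrix.vecMulVec_mul_vecMulVec,
      Matrix.trace_vecMulVec, dotProduct_smul, hdot, smul_eq_mul, sq (‖u‖ ^ 2)]
  calc u.ofLp ⬝ᵥ (M *ᵥ u.ofLp) = (M * Matrix.vecMulVec u.ofLp u.ofLp).trace := by
        rw [Matrix.mul_vecMulVec, Matrix.trace_vecMulVec, dotProduct_comm]
    _ ≤ ‖M‖ * ‖u‖ ^ 2 := hnorm ▸ (le_abs_self _).trans (abs_trace_mul_le _ _)

end Frobenius

section Weyl

variable {m : ℕ} {X Y : Matrix (Fin m) (Fin m) ℝ}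

theorem exists_ne_zero_forall_inner_eq_zero {ι E : Type*} [Fintype ι] [NormedAddCommGroup E]
    [InnerProductSpace ℝ E] [FiniteDimensional ℝ E] (f : ι → E)
    (hι : Fintype.card ι < Module.finrank ℝ E) : ∃ u ≠ 0, ∀ i, ⟪f i, u⟫ = 0 := by
  have hspan : Submodule.span ℝ (Set.range f) ≠ ⊤ := fun htop =>
    (finrank_range_le_card f).not_gt <| by rwa [Set.finrank, htop, finrank_top]
  obtain ⟨u, hu, hu0⟩ :=
    Submodule.exists_mem_ne_zero_of_ne_bot (mt Submodule.orthogonal_eq_bot_iff.1 hspan)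
  exact ⟨u, hu0, fun i => hu _ (Submodule.subset_span (Set.mem_range_self i))⟩

theorem dotProduct_mulVec_eq_sum (hX : X.IsSymm) (u : EuclideanSpace ℝ (Fin m)) :
    u.ofLp ⬝ᵥ (X *ᵥ u.ofLp) = ∑ k, eigval X k * ⟪eigvecBasis hX k, u⟫ ^ 2 := by
  set v := eigvecBasis hX with hv
  have hinner (k : Fin m) : ⟪v k, Matrix.toEuclideanCLM (𝕜 := ℝ) X u⟫ = eigval X k * ⟪v k, u⟫ := by
    rw [Matrix.inner_toEuclideanCLM, Matrix.dotProduct_mulVec, ← Matrix.mulVec_transpose, hX.eq,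
      hv, mulVec_eigvecBasis, smul_dotProduct, smul_eq_mul, dotProduct_comm,
      EuclideanSpace.inner_eq_star_dotProduct, star_trivial]
  rw [← Matrix.inner_toEuclideanCLM, ← v.sum_inner_mul_inner]
  refine Finset.sum_congr rfl fun k _ => ?_
  rw [hinner, real_inner_comm]
  ring

theorem eigval_mul_le_dotProduct_mulVec (hX : X.IsSymm) {j : Fin m}
    {u : EuclideanSpace ℝ (Fin m)} (hu : ∀ k < j, ⟪eigvecBasis hX k, u⟫ = 0) :
    eigval X j * ‖u‖ ^ 2 ≤ u.ofLp ⬝ᵥ (X *ᵥ u.ofLp) := by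
  rw [dotProduct_mulVec_eq_sum hX, ← (eigvecBasis hX).sum_sq_inner_right, Finset.mul_sum]
  refine Finset.sum_le_sum fun k _ => ?_
  obtain hk | hk := lt_or_ge k j
  · simp [hu k hk]
  · gcongr
    exact monotone_eigval hX hk

theorem dotProduct_mulVec_le_eigval_mul (hX : X.IsSymm) {j : Fin m}
    {u : EuclideanSpace ℝ (Fin m)} (hu : ∀ k > j, ⟪eigvecBasis hX k, u⟫ = 0) :
    u.ofLp ⬝ᵥ (X *ᵥ u.ofLp) ≤ eigval X j * ‖u‖ ^ 2 := by
  rw [dotProduct_mulVec_eq_sum hX, ← (eigvecBasis hX).sum_sq_inner_right, Finset.mul_sum]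
  refine Finset.sum_le_sum fun k _ => ?_
  obtain hk | hk := le_or_gt k j
  · gcongr
    exact monotone_eigval hX hk
  · simp [hu k hk]

-- Weyl's inequality. The eigenvectors of `X` below `j` and those of `Y` above `j` are only
-- `m - 1` vectors, so some `u ≠ 0` is orthogonal to all of them.
theorem eigval_sub_le (hX : X.IsSymm) (hY : Y.IsSymm) (j : Fin m) :
    eigval X j - eigval Y j ≤ ‖X - Y‖ := by
  obtain ⟨u, hu0, hu⟩ := exists_ne_zero_forall_inner_eq_zero
    (fun k : {k // k ≠ j} => if k.1 < j then eigvecBasis hX k else eigvecBasis hY k) (by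
      rw [finrank_euclideanSpace_fin, Fintype.card_subtype_compl, Fintype.card_fin,
        Fintype.card_subtype_eq]
      exact Nat.sub_lt j.pos one_pos)
  have hXu : ∀ k < j, ⟪eigvecBasis hX k, u⟫ = 0 := fun k hk => by
    simpa [hk] using hu ⟨k, hk.ne⟩
  have hYu : ∀ k > j, ⟪eigvecBasis hY k, u⟫ = 0 := fun k hk => by
    simpa [hk.not_gt] using hu ⟨k, hk.ne'⟩
  refine le_of_mul_le_mul_right ?_ (pow_pos (norm_pos_iff.2 hu0) 2)
  calc (eigval X j - eigval Y j) * ‖u‖ ^ 2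
      ≤ u.ofLp ⬝ᵥ ((X - Y) *ᵥ u.ofLp) := by
        rw [Matrix.sub_mulVec, dotProduct_sub, sub_mul]
        exact sub_le_sub (eigval_mul_le_dotProduct_mulVec hX hXu)
          (dotProduct_mulVec_le_eigval_mul hY hYu)
    _ ≤ ‖X - Y‖ * ‖u‖ ^ 2 := dotProduct_mulVec_le _ _

theorem lipschitzOnWith_eigval (j : Fin m) :
    LipschitzOnWith 1 (fun X => eigval X j) {X : Matrix (Fin m) (Fin m) ℝ | X.IsSymm} :=
  LipschitzOnWith.of_le_add fun X hX Y hY => by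
    rw [dist_eq_norm]
    exact sub_le_iff_le_add'.1 (eigval_sub_le hX hY j)

end Weyl

section StarProjection

variable {n : Type*} [Fintype n] [DecidableEq n] {P Q : Matrix n n ℝ}

theorem norm_mul_sq_of_isStarProjection (hP : IsStarProjection P) (hQ : IsStarProjection Q) :
    ‖P * Q‖ ^ 2 = (P * Q).trace := by
  have hPt : Pᵀ = P := Matrix.isHermitian_iff_isSymm.1 hP.isSelfAdjoint
  have hQt : Qᵀ = Q := Matrix.isHermitian_iff_isSymm.1 hQ.isSelfAdjoint
  rw [frobenius_norm_sq, Matrix.transpose_mul, hPt, hQt, ← mul_assoc, mul_assoc P Q Q,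
    hQ.isIdempotentElem.eq, Matrix.trace_mul_comm, ← mul_assoc, hP.isIdempotentElem.eq]

theorem norm_sq_of_isStarProjection (hP : IsStarProjection P) : ‖P‖ ^ 2 = P.trace := by
  simpa only [hP.isIdempotentElem.eq] using norm_mul_sq_of_isStarProjection hP hP

theorem norm_eq_of_trace_eq (hP : IsStarProjection P) (hQ : IsStarProjection Q)
    (htr : P.trace = Q.trace) : ‖P‖ = ‖Q‖ := by
  rwa [← sq_eq_sq₀ (norm_nonneg _) (norm_nonneg _), norm_sq_of_isStarProjection hP,
    norm_sq_of_isStarProjection hQ]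

theorem norm_compl_mul_eq_norm_mul_compl (hP : IsStarProjection P) (hQ : IsStarProjection Q)
    (htr : P.trace = Q.trace) : ‖(1 - P) * Q‖ = ‖P * (1 - Q)‖ := by
  rw [← sq_eq_sq₀ (norm_nonneg _) (norm_nonneg _), norm_mul_sq_of_isStarProjection hP.one_sub hQ,
    norm_mul_sq_of_isStarProjection hP hQ.one_sub, sub_mul, mul_sub, one_mul, mul_one,
    Matrix.trace_sub, Matrix.trace_sub, htr]

theorem norm_sub_le_two_mul_norm_compl_mul (hP : IsStarProjection P) (hQ : IsStarProjection Q)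
    (htr : P.trace = Q.trace) : ‖Q - P‖ ≤ 2 * ‖(1 - P) * Q‖ := by
  calc ‖Q - P‖ = ‖(1 - P) * Q - P * (1 - Q)‖ := by congr 1; noncomm_ring
    _ ≤ ‖(1 - P) * Q‖ + ‖P * (1 - Q)‖ := norm_sub_le _ _
    _ = 2 * ‖(1 - P) * Q‖ := by rw [← norm_compl_mul_eq_norm_mul_compl hP hQ htr, two_mul]

end StarProjection

section Perturbation

variable {m : ℕ} {X Y : Matrix (Fin m) (Fin m) ℝ}

theorem abs_eigval_sub_le (hX : X.IsSymm) (hY : Y.IsSymm) (j : Fin m) :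
    |eigval X j - eigval Y j| ≤ ‖X - Y‖ := by
  simpa [dist_eq_norm] using (lipschitzOnWith_eigval j).dist_le_mul X hX Y hY

theorem compl_eigproj_mul_eigproj (hX : X.IsSymm) (Y : Matrix (Fin m) (Fin m) ℝ) (j : Fin m) :
    (1 - eigproj X j) * eigproj Y j =
      pinv X j * ((Y - X - (eigval Y j - eigval X j) • 1) * eigproj Y j) := by
  rw [← pinv_mul_sub hX, mul_assoc]
  congr 1
  simp only [sub_mul, smul_mul_assoc, one_mul, mul_eigproj, sub_smul]
  abel

theorem eigproj_mul_sub_mul_eigproj (hX : X.IsSymm) (Y : Matrix (Fin m) (Fin m) ℝ) (j : Fin m) :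
    eigproj X j * (Y - X) * eigproj Y j =
      (eigval Y j - eigval X j) • (eigproj X j * eigproj Y j) := by
  rw [mul_sub, sub_mul, mul_assoc, mul_eigproj, eigproj_mul hX, mul_smul_comm, smul_mul_assoc,
    sub_smul]

theorem norm_compl_eigproj_mul_eigproj_le (hX : X.IsSymm) (hY : Y.IsSymm) (j : Fin m) :
    ‖(1 - eigproj X j) * eigproj Y j‖ ≤ 2 * ‖pinv X j‖ * ‖eigproj Y j‖ * ‖Y - X‖ := by
  have hsum : ‖(Y - X - (eigval Y j - eigval X j) • 1) * eigproj Y j‖ ≤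
      ‖Y - X‖ * ‖eigproj Y j‖ + ‖Y - X‖ * ‖eigproj Y j‖ := by
    rw [sub_mul, smul_one_mul]
    refine (norm_sub_le _ _).trans (add_le_add (norm_mul_le _ _) ?_)
    rw [norm_smul]
    gcongr
    exact abs_eigval_sub_le hY hX j
  rw [compl_eigproj_mul_eigproj hX]
  refine (norm_mul_le _ _).trans ((mul_le_mul_of_nonneg_left hsum (norm_nonneg _)).trans_eq ?_)
  ring

theorem norm_eigproj_sub_le (hX : X.IsSymm) (hY : Y.IsSymm) {j : Fin m}
    (htr : (eigproj Y j).trace = (eigproj X j).trace) :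
    ‖eigproj Y j - eigproj X j‖ ≤ 4 * ‖pinv X j‖ * ‖eigproj X j‖ * ‖Y - X‖ := by
  have hP := isStarProjection_eigproj X j
  have hQ := isStarProjection_eigproj Y j
  refine (norm_sub_le_two_mul_norm_compl_mul hP hQ htr.symm).trans ?_
  rw [norm_eq_of_trace_eq hP hQ htr.symm]
  linarith [norm_compl_eigproj_mul_eigproj_le hX hY j]

end Perturbation

theorem hasFDerivAt_mul_of_eq_zero {𝕜 V 𝔸 : Type*} [NontriviallyNormedField 𝕜]
    [NormedAddCommGroup V] [NormedSpace 𝕜 V] [NormedRing 𝔸] [NormedAlgebra 𝕜 𝔸]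
    {f g : V → 𝔸} {f' : V →L[𝕜] 𝔸} {x : V} (hf : HasFDerivAt f f' x) (hfx : f x = 0)
    (hg : ContinuousAt g x) :
    HasFDerivAt (fun y => f y * g y) ((ContinuousLinearMap.mul 𝕜 𝔸).flip (g x) ∘L f') x := by
  have hconst : HasFDerivAt (fun y => f y * g x)
      ((ContinuousLinearMap.mul 𝕜 𝔸).flip (g x) ∘L f') x :=
    ((ContinuousLinearMap.mul 𝕜 𝔸).flip (g x)).hasFDerivAt.comp x hf
  have hsmall : HasFDerivAt (fun y => f y * (g y - g x)) (0 : V →L[𝕜] 𝔸) x := by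
    rw [hasFDerivAt_iff_isLittleO]
    have hf' : f =O[𝓝 x] fun y => y - x := by simpa [hfx] using hf.isBigO_sub
    have hg' : (fun y => g y - g x) =o[𝓝 x] fun _ => (1 : ℝ) :=
      (Asymptotics.isLittleO_one_iff ℝ).2 (tendsto_sub_nhds_zero_iff.2 hg)
    simpa [hfx] using hf'.norm_right.mul_isLittleO hg'
  simpa [mul_sub] using hconst.fun_add hsmall

/-- Near `x` the matrices `H y` are symmetric and the multiplicity `tr P_j(y)` of their `j`-th
eigenvalue is constant. This is the pointwise form of the hypothesis "`tr P_j` is constant in `Ω`"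
for `x` in the open set `Ω`. -/
def ConstMultAt {V : Type*} [TopologicalSpace V] {m : ℕ} (H : V → Matrix (Fin m) (Fin m) ℝ)
    (j : Fin m) (x : V) : Prop :=
  ∀ᶠ y in 𝓝 x, (H y).IsSymm ∧ (eigproj (H y) j).trace = (eigproj (H x) j).trace

theorem isSymm_lineDeriv {V n : Type*} [NormedAddCommGroup V] [NormedSpace ℝ V] [Fintype n]
    {F : V → Matrix n n ℝ} {x : V} (hF : ∀ᶠ y in 𝓝 x, (F y).IsSymm) (e : V) :
    (lineDeriv ℝ F x e).IsSymm := by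
  have hstar : (fun y => star (F y)) =ᶠ[𝓝 x] F := by
    filter_upwards [hF] with y hy using Matrix.isHermitian_iff_isSymm.2 hy
  calc (lineDeriv ℝ F x e)ᵀ = lineDeriv ℝ (fun y => star (F y)) x e := deriv.star.symm
    _ = lineDeriv ℝ F x e := hstar.lineDeriv_eq

namespace ConstMultAt

section Topological

variable {V : Type*} [TopologicalSpace V] {m : ℕ} {H : V → Matrix (Fin m) (Fin m) ℝ} {j : Fin m}
  {x : V}

theorem isSymm (h : ConstMultAt H j x) : (H x).IsSymm := h.self_of_nhds.1

theorem eventually (h : ConstMultAt H j x) : ∀ᶠ y in 𝓝 x, ConstMultAt H j y := by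
  filter_upwards [h.eventually_nhds] with y hy
  filter_upwards [hy] with z hz
  exact ⟨hz.1, hz.2.trans hy.self_of_nhds.2.symm⟩

theorem eigproj_sub_isBigO (h : ConstMultAt H j x) :
    (fun y => eigproj (H y) j - eigproj (H x) j) =O[𝓝 x] fun y => H y - H x := by
  refine .of_bound (4 * ‖pinv (H x) j‖ * ‖eigproj (H x) j‖) ?_
  filter_upwards [h] with y hy using norm_eigproj_sub_le h.isSymm hy.1 hy.2

theorem continuousAt_eigproj (h : ConstMultAt H j x) (hH : ContinuousAt H x) :
    ContinuousAt (fun y => eigproj (H y) j) x :=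
  tendsto_sub_nhds_zero_iff.1 <| h.eigproj_sub_isBigO.trans_tendsto <|
    tendsto_sub_nhds_zero_iff.2 hH

end Topological

section Differentiable

variable {V : Type*} [NormedAddCommGroup V] [NormedSpace ℝ V] {m : ℕ}
  {H : V → Matrix (Fin m) (Fin m) ℝ} {j : Fin m} {x : V}

-- As the factor `H y - H x` vanishes at `x`, the derivative of `P_j` does not enter.
theorem hasFDerivAt_eigproj_mul_sub_mul_eigproj (h : ConstMultAt H j x)
    (hH : DifferentiableAt ℝ H x) :
    HasFDerivAt (fun y => eigproj (H x) j * (H y - H x) * eigproj (H y) j)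
      (ContinuousLinearMap.mulLeftRight ℝ _ (eigproj (H x) j) (eigproj (H x) j) ∘L fderiv ℝ H x)
      x := by
  have hsub : HasFDerivAt (fun y => eigproj (H x) j * (H y - H x)) _ x :=
    (hH.hasFDerivAt.sub_const (H x)).const_mul (eigproj (H x) j)
  refine (hasFDerivAt_mul_of_eq_zero hsub (by simp)
    (h.continuousAt_eigproj hH.continuousAt)).congr_fderiv ?_
  ext1 e
  rfl

theorem differentiableAt_eigval (h : ConstMultAt H j x) (hH : DifferentiableAt ℝ H x) :
    DifferentiableAt ℝ (fun y => eigval (H y) j) x := by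
  have htrace : ContinuousAt (fun y => (eigproj (H x) j * eigproj (H y) j).trace) x :=
    (continuous_id.matrix_trace.continuousAt).comp
      (continuousAt_const.mul (h.continuousAt_eigproj hH.continuousAt))
  have htrace_ne : (eigproj (H x) j * eigproj (H x) j).trace ≠ 0 := by
    rw [eigproj_mul_self]
    exact (trace_eigproj_pos h.isSymm j).ne'
  have hnum : DifferentiableAt ℝ
      (fun y => (eigproj (H x) j * (H y - H x) * eigproj (H y) j).trace) x :=
    (Matrix.traceLinearMap (Fin m) ℝ ℝ).toContinuousLinearMap.differentiableAt.comp x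
      (h.hasFDerivAt_eigproj_mul_sub_mul_eigproj hH).differentiableAt
  have hinv : ContinuousAt (fun y => (eigproj (H x) j * eigproj (H y) j).trace⁻¹) x :=
    htrace.inv₀ htrace_ne
  have hquot := hasFDerivAt_mul_of_eq_zero hnum.hasFDerivAt (by simp) hinv
  refine (hquot.differentiableAt.add_const (eigval (H x) j)).congr_of_eventuallyEq ?_
  filter_upwards [htrace.eventually_ne htrace_ne] with y hy
  rw [eigproj_mul_sub_mul_eigproj h.isSymm, Matrix.trace_smul, smul_eq_mul,
    mul_inv_cancel_right₀ hy, sub_add_cancel]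

theorem lineDeriv_eigval_smul (h : ConstMultAt H j x) (hH : DifferentiableAt ℝ H x) (e : V) :
    lineDeriv ℝ (fun y => eigval (H y) j) x e • eigproj (H x) j =
      eigproj (H x) j * lineDeriv ℝ H x e * eigproj (H x) j := by
  have hlam := h.differentiableAt_eigval hH
  have hleft : HasFDerivAt (fun y => (eigval (H y) j - eigval (H x) j) •
      (1 : Matrix (Fin m) (Fin m) ℝ)) _ x := (hlam.hasFDerivAt.sub_const _).smul_const _
  have hprod := hasFDerivAt_mul_of_eq_zero hleft (by simp)
    ((h.continuousAt_eigproj hH.continuousAt).const_mul (eigproj (H x) j))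
  simp only [smul_mul_assoc, one_mul, ← eigproj_mul_sub_mul_eigproj h.isSymm] at hprod
  have huniq : (fderiv ℝ (fun y => eigval (H y) j) x e • (1 : Matrix (Fin m) (Fin m) ℝ)) *
      (eigproj (H x) j * eigproj (H x) j) =
        eigproj (H x) j * fderiv ℝ H x e * eigproj (H x) j :=
    DFunLike.congr_fun (hprod.unique (h.hasFDerivAt_eigproj_mul_sub_mul_eigproj hH)) e
  rw [hlam.lineDeriv_eq_fderiv, hH.lineDeriv_eq_fderiv]
  rwa [eigproj_mul_self, smul_one_mul] at huniq

theorem hasFDerivAt_compl_mul_eigproj (h : ConstMultAt H j x) (hH : DifferentiableAt ℝ H x) :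
    HasFDerivAt (fun y => (1 - eigproj (H x) j) * eigproj (H y) j)
      (ContinuousLinearMap.mulLeftRight ℝ _ (pinv (H x) j) (eigproj (H x) j) ∘L fderiv ℝ H x)
      x := by
  have hleft : HasFDerivAt (fun y => H y - H x - (eigval (H y) j - eigval (H x) j) •
      (1 : Matrix (Fin m) (Fin m) ℝ)) _ x :=
    (hH.hasFDerivAt.sub_const _).fun_sub
      (((h.differentiableAt_eigval hH).hasFDerivAt.sub_const _).smul_const _)
  have hprod := hasFDerivAt_mul_of_eq_zero hleft (by simp)
    (h.continuousAt_eigproj hH.continuousAt)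
  simp only [compl_eigproj_mul_eigproj h.isSymm]
  refine (hprod.const_mul (pinv (H x) j)).congr_fderiv ?_
  ext1 e
  change pinv (H x) j * ((fderiv ℝ H x e - fderiv ℝ (fun y => eigval (H y) j) x e • 1) *
    eigproj (H x) j) = pinv (H x) j * fderiv ℝ H x e * eigproj (H x) j
  rw [sub_mul, smul_one_mul, mul_sub, mul_smul_comm, pinv_mul_eigproj h.isSymm, smul_zero,
    sub_zero, mul_assoc]

theorem hasFDerivAt_eigproj_sub_sq (h : ConstMultAt H j x) (hH : DifferentiableAt ℝ H x) :
    HasFDerivAt (fun y => (eigproj (H y) j - eigproj (H x) j) *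
      (eigproj (H y) j - eigproj (H x) j)) (0 : V →L[ℝ] Matrix (Fin m) (Fin m) ℝ) x := by
  have hO : (fun y => eigproj (H y) j - eigproj (H x) j) =O[𝓝 x] fun y => ‖y - x‖ :=
    (h.eigproj_sub_isBigO.trans hH.hasFDerivAt.isBigO_sub).norm_right
  refine Asymptotics.IsBigO.hasFDerivAt (n := 2) ?_ one_lt_two
  simpa only [pow_two] using hO.mul hO

theorem hasFDerivAt_eigproj (h : ConstMultAt H j x) (hH : DifferentiableAt ℝ H x) :
    HasFDerivAt (fun y => eigproj (H y) j)
      ((ContinuousLinearMap.mulLeftRight ℝ _ (pinv (H x) j) (eigproj (H x) j) +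
        ContinuousLinearMap.mulLeftRight ℝ _ (eigproj (H x) j) (pinv (H x) j)) ∘L fderiv ℝ H x)
      x := by
  have hcompl := h.hasFDerivAt_compl_mul_eigproj hH
  have hsplit := ((hcompl.fun_add hcompl.star).fun_sub
    (h.hasFDerivAt_eigproj_sub_sq hH)).const_add (eigproj (H x) j)
  -- Projections satisfy `Q = P + (1 - P) Q + Q (1 - P) - (Q - P)²`, here for `P = P_j(x)` and
  -- `Q = P_j(y)`.
  refine (hsplit.congr_of_eventuallyEq (.of_forall fun y => ?_)).congr_fderiv ?_
  · have hP := isStarProjection_eigproj (H x) j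
    have hQ := isStarProjection_eigproj (H y) j
    simp only [star_mul, star_sub, hP.isSelfAdjoint.star_eq, hQ.isSelfAdjoint.star_eq,
      sub_mul, mul_sub, one_mul, hP.isIdempotentElem.eq, hQ.isIdempotentElem.eq]
    abel
  · ext1 e
    have hsymm := isSymm_lineDeriv (h.mono fun y hy => hy.1) e
    have hfderiv : fderiv ℝ H x e = lineDeriv ℝ H x e := hH.lineDeriv_eq_fderiv.symm
    change pinv (H x) j * fderiv ℝ H x e * eigproj (H x) j +
      (pinv (H x) j * fderiv ℝ H x e * eigproj (H x) j)ᵀ - 0 =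
        pinv (H x) j * fderiv ℝ H x e * eigproj (H x) j +
          eigproj (H x) j * fderiv ℝ H x e * pinv (H x) j
    rw [hfderiv, sub_zero, Matrix.transpose_mul, Matrix.transpose_mul, hsymm.eq,
      (isSymm_pinv _ _).eq, (isSymm_eigproj _ _).eq, mul_assoc (eigproj (H x) j)]

theorem lineDeriv_eigproj (h : ConstMultAt H j x) (hH : DifferentiableAt ℝ H x) (e : V) :
    lineDeriv ℝ (fun y => eigproj (H y) j) x e =
      pinv (H x) j * lineDeriv ℝ H x e * eigproj (H x) j +
        eigproj (H x) j * lineDeriv ℝ H x e * pinv (H x) j := by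
  rw [hH.lineDeriv_eq_fderiv]
  exact ((h.hasFDerivAt_eigproj hH).hasLineDerivAt e).lineDeriv

end Differentiable

end ConstMultAt

section Compression

variable {n : Type*} [Fintype n] {P M : Matrix n n ℝ} {s : ℝ}

theorem eq_trace_of_smul_eq (hP : IsIdempotentElem P) (htr : P.trace ≠ 0)
    (h : s • P = P * M * P) : s = 1 / P.trace * (P * M).trace := by
  have hs := congrArg Matrix.trace h
  rw [Matrix.trace_smul, smul_eq_mul, Matrix.trace_mul_comm, ← mul_assoc, hP.eq] at hs
  rw [← hs, mul_comm s, ← mul_assoc, one_div_mul_cancel htr, one_mul]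

theorem trace_mul_transpose (hP : P.IsSymm) (N : Matrix n n ℝ) :
    (P * Nᵀ).trace = (P * N).trace := by
  rw [← Matrix.trace_transpose, Matrix.transpose_mul, Matrix.transpose_transpose, hP.eq,
    Matrix.trace_mul_comm]

theorem dotProduct_transpose_mulVec (ξ : n → ℝ) (N : Matrix n n ℝ) :
    ξ ⬝ᵥ (Nᵀ *ᵥ ξ) = ξ ⬝ᵥ (N *ᵥ ξ) := by
  rw [Matrix.mulVec_transpose, dotProduct_comm, Matrix.dotProduct_mulVec]

end Compression

section UnitRange

variable {m : ℕ} {P M : Matrix (Fin m) (Fin m) ℝ} {s : ℝ} {ξ : Fin m → ℝ}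

theorem mulVec_of_mem_unitRange (hP : IsIdempotentElem P) (hξ : ξ ∈ unitRange P) :
    P *ᵥ ξ = ξ := by
  obtain ⟨⟨η, rfl⟩, -⟩ := hξ
  rw [Matrix.mulVec_mulVec, hP.eq]

theorem eq_dotProduct_of_smul_eq (hP : IsStarProjection P) (hξ : ξ ∈ unitRange P)
    (h : s • P = P * M * P) : s = ξ ⬝ᵥ (M *ᵥ ξ) := by
  have hPξ := mulVec_of_mem_unitRange hP.isIdempotentElem hξ
  have hξP : ξ ᵥ* P = ξ := by
    rw [← Matrix.mulVec_transpose, (Matrix.isHermitian_iff_isSymm.1 hP.isSelfAdjoint).eq, hPξ]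
  have hs := congrArg (fun N => ξ ⬝ᵥ (N *ᵥ ξ)) h
  simpa only [Matrix.smul_mulVec, dotProduct_smul, hPξ, hξ.2, smul_eq_mul, mul_one,
    ← Matrix.mulVec_mulVec, Matrix.dotProduct_mulVec ξ P, hξP] using hs

end UnitRange

section LineDeriv

variable {V : Type*} [NormedAddCommGroup V] [NormedSpace ℝ V] {x e : V}

theorem lineDeriv_clm_comp {E W : Type*} [NormedAddCommGroup E] [NormedSpace ℝ E]
    [NormedAddCommGroup W] [NormedSpace ℝ W] (L : E →L[ℝ] W) {F : V → E}
    (hF : DifferentiableAt ℝ F x) (e : V) :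
    lineDeriv ℝ (fun y => L (F y)) x e = L (lineDeriv ℝ F x e) := by
  have hLF := L.hasFDerivAt.comp x hF.hasFDerivAt
  rw [hF.lineDeriv_eq_fderiv]
  exact (hLF.hasLineDerivAt e).lineDeriv

theorem lineDeriv_fun_mul {𝔸 : Type*} [NormedRing 𝔸] [NormedAlgebra ℝ 𝔸] {F G : V → 𝔸}
    (hF : DifferentiableAt ℝ F x) (hG : DifferentiableAt ℝ G x) (e : V) :
    lineDeriv ℝ (fun y => F y * G y) x e =
      F x * lineDeriv ℝ G x e + lineDeriv ℝ F x e * G x := by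
  rw [hF.lineDeriv_eq_fderiv, hG.lineDeriv_eq_fderiv]
  exact ((hF.hasFDerivAt.mul' hG.hasFDerivAt).hasLineDerivAt e).lineDeriv

theorem lineDeriv_fun_smul {E : Type*} [NormedAddCommGroup E] [NormedSpace ℝ E] {c : V → ℝ}
    {F : V → E} (hc : DifferentiableAt ℝ c x) (hF : DifferentiableAt ℝ F x) (e : V) :
    lineDeriv ℝ (fun y => c y • F y) x e =
      c x • lineDeriv ℝ F x e + lineDeriv ℝ c x e • F x := by
  rw [hc.lineDeriv_eq_fderiv, hF.lineDeriv_eq_fderiv]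
  exact ((hc.hasFDerivAt.smul hF.hasFDerivAt).hasLineDerivAt e).lineDeriv

theorem differentiableAt_lineDeriv {E : Type*} [NormedAddCommGroup E] [NormedSpace ℝ E]
    {F : V → E} (hF : ContDiffAt ℝ 2 F x) (a : V) :
    DifferentiableAt ℝ (fun y => lineDeriv ℝ F y a) x := by
  have hF' : DifferentiableAt ℝ (fderiv ℝ F) x :=
    (hF.fderiv_right (m := 1) one_add_one_eq_two.le).differentiableAt one_ne_zero
  refine (hF'.clm_apply (differentiableAt_const a)).congr_of_eventuallyEq ?_
  filter_upwards [hF.eventually (by simp)] with y hy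
  exact (hy.differentiableAt two_ne_zero).lineDeriv_eq_fderiv

theorem norm_lineDeriv_le_sSup {E : Type*} [NormedAddCommGroup E] [NormedSpace ℝ E]
    {F : V → E} (hF : DifferentiableAt ℝ F x) (he : ‖e‖ = 1) :
    ‖lineDeriv ℝ F x e‖ ≤ sSup ((fun e => ‖lineDeriv ℝ F x e‖) '' Metric.sphere 0 1) := by
  refine le_csSup ⟨‖fderiv ℝ F x‖, ?_⟩ ⟨e, by simpa using he, rfl⟩
  rintro - ⟨v, hv, rfl⟩
  have hv' : ‖v‖ = 1 := by simpa using hv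
  change ‖lineDeriv ℝ F x v‖ ≤ ‖fderiv ℝ F x‖
  rw [hF.lineDeriv_eq_fderiv]
  simpa [hv'] using (fderiv ℝ F x).le_opNorm v

end LineDeriv

section Gradient

variable {V : Type*} [NormedAddCommGroup V] [InnerProductSpace ℝ V] [CompleteSpace V]
  {f : V → ℝ} {x : V}

theorem inner_gradient (hf : DifferentiableAt ℝ f x) (e : V) :
    ⟪gradient f x, e⟫ = lineDeriv ℝ f x e := by
  rw [hf.lineDeriv_eq_fderiv, inner_gradient_left]

theorem norm_gradient_le (hf : DifferentiableAt ℝ f x) {C : ℝ} (hC : 0 ≤ C)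
    (hle : ∀ e, ‖e‖ = 1 → |lineDeriv ℝ f x e| ≤ C) : ‖gradient f x‖ ≤ C := by
  rw [gradient, LinearIsometryEquiv.norm_map]
  refine ContinuousLinearMap.opNorm_le_of_unit_norm hC fun e he => ?_
  simpa only [hf.lineDeriv_eq_fderiv, ← Real.norm_eq_abs] using hle e he

end Gradient

section Jacobian

variable {n k m : ℕ} {x : EuclideanSpace ℝ (Fin n)}

theorem dotProduct_eq_inner (a b : EuclideanSpace ℝ (Fin n)) : a.ofLp ⬝ᵥ b.ofLp = ⟪a, b⟫ := by
  rw [EuclideanSpace.inner_eq_star_dotProduct, star_trivial, dotProduct_comm]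

theorem eq_of_dotProduct_mulVec_eq {M N : Matrix (Fin m) (Fin k) ℝ}
    (h : ∀ (a : EuclideanSpace ℝ (Fin m)) (b : EuclideanSpace ℝ (Fin k)),
      a.ofLp ⬝ᵥ (M *ᵥ b.ofLp) = a.ofLp ⬝ᵥ (N *ᵥ b.ofLp)) : M = N := by
  ext i l
  simpa using h (EuclideanSpace.single i 1) (EuclideanSpace.single l 1)

theorem jacobian_mulVec (f : EuclideanSpace ℝ (Fin n) → EuclideanSpace ℝ (Fin k))
    (x e : EuclideanSpace ℝ (Fin n)) : jacobian f x *ᵥ e.ofLp = (fderiv ℝ f x e).ofLp := by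
  have he : e = ∑ l, e l • EuclideanSpace.single l (1 : ℝ) := by
    ext i
    simp [Finset.sum_apply, Pi.single_apply]
  ext i
  conv_rhs => rw [he, map_sum]
  simp [jacobian, Matrix.mulVec, dotProduct, mul_comm]

theorem jacDeriv_mulVec {F : EuclideanSpace ℝ (Fin n) → Matrix (Fin m) (Fin k) ℝ}
    (hF : DifferentiableAt ℝ F x) (q : Fin k → ℝ) (e : EuclideanSpace ℝ (Fin n)) :
    jacDeriv q F x *ᵥ e.ofLp = lineDeriv ℝ F x e *ᵥ q := by
  let L : Matrix (Fin m) (Fin k) ℝ →L[ℝ] EuclideanSpace ℝ (Fin m) :=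
    ((WithLp.linearEquiv 2 ℝ (Fin m → ℝ)).symm.toLinearMap ∘ₗ
      (Matrix.mulVecBilin ℝ ℝ).flip q).toContinuousLinearMap
  have hLF : DifferentiableAt ℝ (fun y => L (F y)) x := L.differentiableAt.comp x hF
  rw [jacDeriv, jacobian_mulVec]
  exact congrArg WithLp.ofLp (hLF.lineDeriv_eq_fderiv.symm.trans (lineDeriv_clm_comp L hF e))

theorem dotProduct_jacobian_gradient_mulVec {f : EuclideanSpace ℝ (Fin n) → ℝ}
    (hf : ∀ᶠ y in 𝓝 x, DifferentiableAt ℝ f y) (hf' : DifferentiableAt ℝ (gradient f) x)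
    (a b : EuclideanSpace ℝ (Fin n)) :
    a.ofLp ⬝ᵥ (jacobian (gradient f) x *ᵥ b.ofLp) =
      lineDeriv ℝ (fun y => lineDeriv ℝ f y a) x b := by
  have hinner : (fun y => lineDeriv ℝ f y a) =ᶠ[𝓝 x] fun y => innerSL ℝ a (gradient f y) := by
    filter_upwards [hf] with y hy
    rw [← inner_gradient hy, innerSL_apply_apply, real_inner_comm]
  rw [hinner.lineDeriv_eq, lineDeriv_clm_comp _ hf', hf'.lineDeriv_eq_fderiv, jacobian_mulVec,
    dotProduct_eq_inner, innerSL_apply_apply]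

theorem differentiableAt_gradient {f : EuclideanSpace ℝ (Fin n) → ℝ}
    (hf : ∀ᶠ y in 𝓝 x, DifferentiableAt ℝ f y)
    (hf' : ∀ a, DifferentiableAt ℝ (fun y => lineDeriv ℝ f y a) x) :
    DifferentiableAt ℝ (gradient f) x := by
  refine differentiableAt_euclidean.2 fun i =>
    (hf' (EuclideanSpace.single i 1)).congr_of_eventuallyEq ?_
  filter_upwards [hf] with y hy
  rw [← inner_gradient hy, EuclideanSpace.inner_single_right]
  simp

theorem gradient_eq_vecMul_jacDeriv {f : EuclideanSpace ℝ (Fin n) → ℝ}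
    {F : EuclideanSpace ℝ (Fin n) → Matrix (Fin m) (Fin k) ℝ} {p : Fin m → ℝ} {q : Fin k → ℝ}
    (hf : DifferentiableAt ℝ f x) (hF : DifferentiableAt ℝ F x)
    (h : ∀ e, lineDeriv ℝ f x e = p ⬝ᵥ (lineDeriv ℝ F x e *ᵥ q)) :
    (gradient f x).ofLp = p ᵥ* jacDeriv q F x := by
  refine dotProduct_eq _ _ fun u => ?_
  have hu := dotProduct_eq_inner (gradient f x) (WithLp.toLp 2 u)
  rw [← Matrix.dotProduct_mulVec]
  exact hu.trans ((inner_gradient hf _).trans ((h _).trans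
    (congrArg (p ⬝ᵥ ·) (jacDeriv_mulVec hF q (WithLp.toLp 2 u)).symm)))

end Jacobian

section Hessian

/-- The quadratic form `ξᵀ M ξ` as a continuous linear form in the matrix `M`, so that it commutes
with directional derivatives. -/
noncomputable def quadForm {m : ℕ} (ξ : Fin m → ℝ) : Matrix (Fin m) (Fin m) ℝ →L[ℝ] ℝ :=
  (dotProductBilin ℝ ℝ ξ ∘ₗ (Matrix.mulVecBilin ℝ ℝ).flip ξ).toContinuousLinearMap

theorem quadForm_apply (ξ : Fin m → ℝ) (M : Matrix (Fin m) (Fin m) ℝ) :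
    quadForm ξ M = ξ ⬝ᵥ (M *ᵥ ξ) := rfl

variable {n m : ℕ} {H : EuclideanSpace ℝ (Fin n) → Matrix (Fin m) (Fin m) ℝ}
  {x : EuclideanSpace ℝ (Fin n)}

-- `(∇_ξ H)ᵀ ξ` is the gradient of `ξᵀ H ξ`.
theorem dotProduct_jacDeriv_transpose_jacDeriv_mulVec (hH : ContDiffAt ℝ 2 H x) (ξ : Fin m → ℝ)
    (a b : EuclideanSpace ℝ (Fin n)) :
    a.ofLp ⬝ᵥ (jacDeriv ξ (fun y => (jacDeriv ξ H y)ᵀ) x *ᵥ b.ofLp) =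
      ξ ⬝ᵥ (lineDeriv ℝ (fun y => lineDeriv ℝ H y a) x b *ᵥ ξ) := by
  have hH' : ∀ᶠ y in 𝓝 x, DifferentiableAt ℝ H y :=
    (hH.eventually (by simp)).mono fun y hy => hy.differentiableAt two_ne_zero
  have hf : ∀ᶠ y in 𝓝 x, DifferentiableAt ℝ (fun y => quadForm ξ (H y)) y :=
    hH'.mono fun y hy => (quadForm ξ).differentiableAt.comp y hy
  have hlineDeriv (a : EuclideanSpace ℝ (Fin n)) :
      (fun y => lineDeriv ℝ (fun y => quadForm ξ (H y)) y a) =ᶠ[𝓝 x]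
        fun y => quadForm ξ (lineDeriv ℝ H y a) :=
    hH'.mono fun y hy => lineDeriv_clm_comp (quadForm ξ) hy a
  have hgradient : (fun y => WithLp.toLp 2 ((jacDeriv ξ H y)ᵀ *ᵥ ξ)) =ᶠ[𝓝 x]
      gradient fun y => quadForm ξ (H y) := by
    filter_upwards [hH', hf] with y hHy hfy
    rw [Matrix.mulVec_transpose, ← gradient_eq_vecMul_jacDeriv hfy hHy fun e =>
      (lineDeriv_clm_comp (quadForm ξ) hHy e).trans (quadForm_apply ..)]
  have hdiff (a : EuclideanSpace ℝ (Fin n)) :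
      DifferentiableAt ℝ (fun y => lineDeriv ℝ (fun y => quadForm ξ (H y)) y a) x :=
    ((quadForm ξ).differentiableAt.comp x (differentiableAt_lineDeriv hH a)).congr_of_eventuallyEq
      (hlineDeriv a)
  calc a.ofLp ⬝ᵥ (jacDeriv ξ (fun y => (jacDeriv ξ H y)ᵀ) x *ᵥ b.ofLp)
    _ = a.ofLp ⬝ᵥ (jacobian (gradient fun y => quadForm ξ (H y)) x *ᵥ b.ofLp) := by
      rw [jacDeriv, jacobian_mulVec, jacobian_mulVec, hgradient.fderiv_eq]
    _ = lineDeriv ℝ (fun y => quadForm ξ (lineDeriv ℝ H y a)) x b := by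
      rw [dotProduct_jacobian_gradient_mulVec hf (differentiableAt_gradient hf hdiff),
        (hlineDeriv a).lineDeriv_eq]
    _ = ξ ⬝ᵥ (lineDeriv ℝ (fun y => lineDeriv ℝ H y a) x b *ᵥ ξ) :=
      lineDeriv_clm_comp (quadForm ξ) (differentiableAt_lineDeriv hH a) b

end Hessian

theorem smul_eq_of_product_rule {𝕜 R : Type*} [CommSemiring 𝕜] [Ring R] [Algebra 𝕜 R]
    {P A B D M M' : R} {s t : 𝕜}
    (hP : P * P = P) (hAP : A * P = 0) (hPD : P * D = P * B * A) (hDP : D * P = A * B * P)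
    (h : s • D + t • P = P * M * D + (P * M' + D * M) * P) :
    t • P = P * (M' + M * A * B + B * A * M) * P := by
  have hPDP : P * D * P = 0 := by rw [hPD, mul_assoc, hAP, mul_zero]
  calc t • P = P * (s • D + t • P) * P := by
        rw [mul_add, add_mul, mul_smul_comm, smul_mul_assoc, hPDP, smul_zero, zero_add,
          mul_smul_comm, smul_mul_assoc, hP, hP]
    _ = P * P * M * (D * P) + P * P * M' * (P * P) + P * D * M * (P * P) := by
        rw [h]
        noncomm_ring
    _ = P * (M' + M * A * B + B * A * M) * P := by
        rw [hP, hPD, hDP]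
        noncomm_ring

namespace ConstMultAt

section SecondOrder

variable {V : Type*} [NormedAddCommGroup V] [NormedSpace ℝ V] {m : ℕ}
  {H : V → Matrix (Fin m) (Fin m) ℝ} {j : Fin m} {x : V}

theorem lineDeriv_eigval_eq_trace (h : ConstMultAt H j x) (hH : DifferentiableAt ℝ H x) (e : V) :
    lineDeriv ℝ (fun y => eigval (H y) j) x e =
      1 / (eigproj (H x) j).trace * (eigproj (H x) j * lineDeriv ℝ H x e).trace :=
  eq_trace_of_smul_eq (eigproj_mul_self _ _) (trace_eigproj_pos h.isSymm j).ne'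
    (h.lineDeriv_eigval_smul hH e)

theorem lineDeriv_eigval_eq_dotProduct (h : ConstMultAt H j x) (hH : DifferentiableAt ℝ H x)
    {ξ : Fin m → ℝ} (hξ : ξ ∈ unitRange (eigproj (H x) j)) (e : V) :
    lineDeriv ℝ (fun y => eigval (H y) j) x e = ξ ⬝ᵥ (lineDeriv ℝ H x e *ᵥ ξ) :=
  eq_dotProduct_of_smul_eq (isStarProjection_eigproj _ _) hξ (h.lineDeriv_eigval_smul hH e)

theorem abs_lineDeriv_eigval_le (h : ConstMultAt H j x) (hH : DifferentiableAt ℝ H x) (e : V) :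
    |lineDeriv ℝ (fun y => eigval (H y) j) x e| ≤
      1 / √(eigproj (H x) j).trace * ‖lineDeriv ℝ H x e‖ := by
  have htr := trace_eigproj_pos h.isSymm j
  have hnorm : ‖eigproj (H x) j‖ = √(eigproj (H x) j).trace := by
    rw [← norm_sq_of_isStarProjection (isStarProjection_eigproj _ _), Real.sqrt_sq (norm_nonneg _)]
  have hsqrt : 1 / (eigproj (H x) j).trace * √(eigproj (H x) j).trace =
      1 / √(eigproj (H x) j).trace := by
    rw [one_div_mul_eq_div, Real.sqrt_div_self']
  rw [h.lineDeriv_eigval_eq_trace hH, abs_mul, abs_of_pos (one_div_pos.2 htr)]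
  calc 1 / (eigproj (H x) j).trace * |(eigproj (H x) j * lineDeriv ℝ H x e).trace|
    _ ≤ 1 / (eigproj (H x) j).trace * (‖eigproj (H x) j‖ * ‖lineDeriv ℝ H x e‖) := by
      gcongr
      exact abs_trace_mul_le _ _
    _ = 1 / √(eigproj (H x) j).trace * ‖lineDeriv ℝ H x e‖ := by rw [hnorm, ← mul_assoc, hsqrt]

theorem eventually_and_differentiableAt (h : ConstMultAt H j x) (hH : ContDiffAt ℝ 2 H x) :
    ∀ᶠ y in 𝓝 x, ConstMultAt H j y ∧ DifferentiableAt ℝ H y :=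
  h.eventually.and ((hH.eventually (by simp)).mono fun y hy => hy.differentiableAt two_ne_zero)

theorem differentiableAt_lineDeriv_eigval (h : ConstMultAt H j x) (hH : ContDiffAt ℝ 2 H x)
    (a : V) : DifferentiableAt ℝ (fun y => lineDeriv ℝ (fun z => eigval (H z) j) y a) x := by
  have hP := (h.hasFDerivAt_eigproj (hH.differentiableAt two_ne_zero)).differentiableAt
  have htrace : DifferentiableAt ℝ (fun y => (eigproj (H y) j * lineDeriv ℝ H y a).trace) x :=
    (Matrix.traceLinearMap (Fin m) ℝ ℝ).toContinuousLinearMap.differentiableAt.comp x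
      (hP.fun_mul (differentiableAt_lineDeriv hH a))
  refine (htrace.const_mul (1 / (eigproj (H x) j).trace)).congr_of_eventuallyEq ?_
  filter_upwards [h.eventually_and_differentiableAt hH, h] with y hy htr
  rw [hy.1.lineDeriv_eigval_eq_trace hy.2, htr.2]

-- The identity `D_aλ P = P D_aH P` is differentiated along `b` and compressed by `P`, where `D_bP`
-- contributes only through `P D_bP = P D_bH A` and `D_bP P = A D_bH P`.
theorem lineDeriv_lineDeriv_eigval_smul (h : ConstMultAt H j x) (hH : ContDiffAt ℝ 2 H x)
    (a b : V) :
    lineDeriv ℝ (fun y => lineDeriv ℝ (fun z => eigval (H z) j) y a) x b • eigproj (H x) j =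
      eigproj (H x) j * (lineDeriv ℝ (fun y => lineDeriv ℝ H y a) x b +
        lineDeriv ℝ H x a * pinv (H x) j * lineDeriv ℝ H x b +
        lineDeriv ℝ H x b * pinv (H x) j * lineDeriv ℝ H x a) * eigproj (H x) j := by
  have hH₁ := hH.differentiableAt two_ne_zero
  have hP := (h.hasFDerivAt_eigproj hH₁).differentiableAt
  have hHa := differentiableAt_lineDeriv hH a
  have hfirst : (fun y => lineDeriv ℝ (fun z => eigval (H z) j) y a • eigproj (H y) j) =ᶠ[𝓝 x]
      fun y => eigproj (H y) j * lineDeriv ℝ H y a * eigproj (H y) j := by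
    filter_upwards [h.eventually_and_differentiableAt hH] with y hy
    exact hy.1.lineDeriv_eigval_smul hy.2 a
  have hsecond : lineDeriv ℝ _ x b = _ := hfirst.lineDeriv_eq
  rw [lineDeriv_fun_smul (h.differentiableAt_lineDeriv_eigval hH a) hP,
    lineDeriv_fun_mul (hP.fun_mul hHa) hP, lineDeriv_fun_mul hP hHa] at hsecond
  have hPP := eigproj_mul_self (H x) j
  refine smul_eq_of_product_rule hPP (pinv_mul_eigproj h.isSymm j) ?_ ?_ hsecond
  · rw [h.lineDeriv_eigproj hH₁, mul_add, ← mul_assoc, ← mul_assoc, ← mul_assoc, ← mul_assoc,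
      eigproj_mul_pinv h.isSymm, hPP, zero_mul, zero_mul, zero_add]
  · rw [h.lineDeriv_eigproj hH₁, add_mul, mul_assoc _ (pinv _ _), pinv_mul_eigproj h.isSymm,
      mul_assoc _ (eigproj _ _), hPP, mul_zero, add_zero]

theorem transpose_lineDeriv_mul_pinv_mul_lineDeriv (h : ConstMultAt H j x) (a b : V) :
    (lineDeriv ℝ H x a * pinv (H x) j * lineDeriv ℝ H x b)ᵀ =
      lineDeriv ℝ H x b * pinv (H x) j * lineDeriv ℝ H x a := by
  have hsymm (e : V) := (isSymm_lineDeriv (h.mono fun y hy => hy.1) e).eq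
  rw [Matrix.transpose_mul, Matrix.transpose_mul, hsymm, hsymm, (isSymm_pinv _ _).eq, mul_assoc]

theorem lineDeriv_lineDeriv_eigval_eq_trace (h : ConstMultAt H j x) (hH : ContDiffAt ℝ 2 H x)
    (a b : V) :
    lineDeriv ℝ (fun y => lineDeriv ℝ (fun z => eigval (H z) j) y a) x b =
      1 / (eigproj (H x) j).trace * (eigproj (H x) j *
        (lineDeriv ℝ (fun y => lineDeriv ℝ H y a) x b +
          (2 : ℝ) • (lineDeriv ℝ H x a * pinv (H x) j * lineDeriv ℝ H x b))).trace := by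
  rw [eq_trace_of_smul_eq (eigproj_mul_self _ _) (trace_eigproj_pos h.isSymm j).ne'
    (h.lineDeriv_lineDeriv_eigval_smul hH a b),
    ← h.transpose_lineDeriv_mul_pinv_mul_lineDeriv a b]
  simp only [mul_add, Matrix.trace_add, two_smul, trace_mul_transpose (isSymm_eigproj _ _),
    add_assoc]

theorem lineDeriv_lineDeriv_eigval_eq_dotProduct (h : ConstMultAt H j x)
    (hH : ContDiffAt ℝ 2 H x) {ξ : Fin m → ℝ} (hξ : ξ ∈ unitRange (eigproj (H x) j)) (a b : V) :
    lineDeriv ℝ (fun y => lineDeriv ℝ (fun z => eigval (H z) j) y a) x b =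
      ξ ⬝ᵥ ((lineDeriv ℝ (fun y => lineDeriv ℝ H y a) x b +
        (2 : ℝ) • (lineDeriv ℝ H x a * pinv (H x) j * lineDeriv ℝ H x b)) *ᵥ ξ) := by
  rw [eq_dotProduct_of_smul_eq (isStarProjection_eigproj _ _) hξ
    (h.lineDeriv_lineDeriv_eigval_smul hH a b),
    ← h.transpose_lineDeriv_mul_pinv_mul_lineDeriv a b, Matrix.add_mulVec, Matrix.add_mulVec,
    dotProduct_add, dotProduct_add, dotProduct_transpose_mulVec, two_smul, Matrix.add_mulVec,
    Matrix.add_mulVec, dotProduct_add, dotProduct_add, add_assoc]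

end SecondOrder

section Euclidean

variable {n m : ℕ} {H : EuclideanSpace ℝ (Fin n) → Matrix (Fin m) (Fin m) ℝ} {j : Fin m}
  {x : EuclideanSpace ℝ (Fin n)} {ξ : Fin m → ℝ}

theorem norm_gradient_eigval_le (h : ConstMultAt H j x) (hH : DifferentiableAt ℝ H x) :
    ‖gradient (fun y => eigval (H y) j) x‖ ≤ 1 / √(eigproj (H x) j).trace *
      sSup ((fun e => ‖lineDeriv ℝ H x e‖) '' Metric.sphere 0 1) := by
  refine norm_gradient_le (h.differentiableAt_eigval hH) ?_ fun e he => ?_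
  · exact mul_nonneg (by positivity) (Real.sSup_nonneg (by rintro - ⟨e, -, rfl⟩; positivity))
  · refine (h.abs_lineDeriv_eigval_le hH e).trans ?_
    gcongr
    exact norm_lineDeriv_le_sSup hH he

theorem lineDeriv_eigval_eq_dotProduct_jacDeriv (h : ConstMultAt H j x)
    (hH : DifferentiableAt ℝ H x) (hξ : ξ ∈ unitRange (eigproj (H x) j))
    (e : EuclideanSpace ℝ (Fin n)) :
    lineDeriv ℝ (fun y => eigval (H y) j) x e = ξ ⬝ᵥ (jacDeriv ξ H x *ᵥ e.ofLp) := by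
  rw [h.lineDeriv_eigval_eq_dotProduct hH hξ, jacDeriv_mulVec hH]

theorem gradient_eigval_eq_vecMul (h : ConstMultAt H j x) (hH : DifferentiableAt ℝ H x)
    (hξ : ξ ∈ unitRange (eigproj (H x) j)) :
    (gradient (fun y => eigval (H y) j) x).ofLp = ξ ᵥ* jacDeriv ξ H x :=
  gradient_eq_vecMul_jacDeriv (h.differentiableAt_eigval hH) hH
    (h.lineDeriv_eigval_eq_dotProduct hH hξ)

theorem dotProduct_hessForm_mulVec (h : ConstMultAt H j x) (hH : ContDiffAt ℝ 2 H x)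
    (ξ : Fin m → ℝ) (a b : EuclideanSpace ℝ (Fin n)) :
    a.ofLp ⬝ᵥ (hessForm H j ξ x *ᵥ b.ofLp) =
      ξ ⬝ᵥ ((lineDeriv ℝ (fun y => lineDeriv ℝ H y a) x b +
        (2 : ℝ) • (lineDeriv ℝ H x a * pinv (H x) j * lineDeriv ℝ H x b)) *ᵥ ξ) := by
  have hH₁ := hH.differentiableAt two_ne_zero
  have hsymm : (lineDeriv ℝ H x a)ᵀ = lineDeriv ℝ H x a :=
    (isSymm_lineDeriv (h.mono fun y hy => hy.1) a).eq
  have hfirst : a.ofLp ⬝ᵥ (((jacDeriv ξ H x)ᵀ * pinv (H x) j * jacDeriv ξ H x) *ᵥ b.ofLp) =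
      ξ ⬝ᵥ ((lineDeriv ℝ H x a * pinv (H x) j * lineDeriv ℝ H x b) *ᵥ ξ) := by
    rw [← Matrix.mulVec_mulVec, ← Matrix.mulVec_mulVec, jacDeriv_mulVec hH₁,
      Matrix.dotProduct_mulVec, Matrix.vecMul_transpose, jacDeriv_mulVec hH₁,
      ← Matrix.mulVec_mulVec, ← Matrix.mulVec_mulVec, Matrix.dotProduct_mulVec ξ,
      ← Matrix.mulVec_transpose, hsymm]
  rw [hessForm, Matrix.add_mulVec, dotProduct_add, Matrix.smul_mulVec, dotProduct_smul, hfirst,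
    dotProduct_jacDeriv_transpose_jacDeriv_mulVec hH, Matrix.add_mulVec, dotProduct_add,
    Matrix.smul_mulVec, dotProduct_smul]

theorem lineDeriv_lineDeriv_eigval_eq_hessForm (h : ConstMultAt H j x) (hH : ContDiffAt ℝ 2 H x)
    (hξ : ξ ∈ unitRange (eigproj (H x) j)) (a b : EuclideanSpace ℝ (Fin n)) :
    lineDeriv ℝ (fun y => lineDeriv ℝ (fun z => eigval (H z) j) y a) x b =
      a.ofLp ⬝ᵥ (hessForm H j ξ x *ᵥ b.ofLp) := by
  rw [h.lineDeriv_lineDeriv_eigval_eq_dotProduct hH hξ, h.dotProduct_hessForm_mulVec hH]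

theorem eventually_differentiableAt_eigval (h : ConstMultAt H j x) (hH : ContDiffAt ℝ 2 H x) :
    ∀ᶠ y in 𝓝 x, DifferentiableAt ℝ (fun z => eigval (H z) j) y :=
  (h.eventually_and_differentiableAt hH).mono fun _ hy => hy.1.differentiableAt_eigval hy.2

theorem differentiableAt_gradient_eigval (h : ConstMultAt H j x) (hH : ContDiffAt ℝ 2 H x) :
    DifferentiableAt ℝ (gradient fun y => eigval (H y) j) x :=
  differentiableAt_gradient (h.eventually_differentiableAt_eigval hH)
    (h.differentiableAt_lineDeriv_eigval hH)

theorem dotProduct_jacobian_gradient_eigval_mulVec (h : ConstMultAt H j x)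
    (hH : ContDiffAt ℝ 2 H x) (a b : EuclideanSpace ℝ (Fin n)) :
    a.ofLp ⬝ᵥ (jacobian (gradient fun y => eigval (H y) j) x *ᵥ b.ofLp) =
      lineDeriv ℝ (fun y => lineDeriv ℝ (fun z => eigval (H z) j) y a) x b :=
  dotProduct_jacobian_gradient_mulVec (h.eventually_differentiableAt_eigval hH)
    (h.differentiableAt_gradient_eigval hH) a b

theorem jacobian_gradient_eigval (h : ConstMultAt H j x) (hH : ContDiffAt ℝ 2 H x)
    (hξ : ξ ∈ unitRange (eigproj (H x) j)) :
    jacobian (gradient fun y => eigval (H y) j) x = hessForm H j ξ x := by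
  refine eq_of_dotProduct_mulVec_eq fun a b => ?_
  rw [h.dotProduct_jacobian_gradient_eigval_mulVec hH,
    h.lineDeriv_lineDeriv_eigval_eq_hessForm hH hξ]

end Euclidean

end ConstMultAt

section Conditions

theorem continuousOn_eigval {X : Type*} [TopologicalSpace X] {m : ℕ}
    {H : X → Matrix (Fin m) (Fin m) ℝ} {s : Set X} (hsymm : ∀ x ∈ s, (H x).IsSymm)
    (hH : ContinuousOn H s) (j : Fin m) : ContinuousOn (fun x => eigval (H x) j) s :=
  (lipschitzOnWith_eigval j).continuousOn.comp hH hsymm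

theorem holderOnWith_eigval {X : Type*} [PseudoEMetricSpace X] {m : ℕ}
    {H : X → Matrix (Fin m) (Fin m) ℝ} {s : Set X} {C α : ℝ≥0} (hsymm : ∀ x ∈ s, (H x).IsSymm)
    (hH : HolderOnWith C α H s) (j : Fin m) : HolderOnWith C α (fun x => eigval (H x) j) s := by
  simpa [Function.comp_def] using
    (holderOnWith_one.2 (lipschitzOnWith_eigval j)).comp hH hsymm

theorem exists_trace_eigproj_eq_of_continuousOn {X : Type*} [TopologicalSpace X] {m : ℕ}
    {H : X → Matrix (Fin m) (Fin m) ℝ} {j : Fin m} {s : Set X} (hs : IsConnected s)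
    (hsymm : ∀ x ∈ s, (H x).IsSymm) (hP : ContinuousOn (fun x => eigproj (H x) j) s) :
    ∃ d : ℝ, ∀ x ∈ s, (eigproj (H x) j).trace = d := by
  obtain ⟨x₀, hx₀⟩ := hs.nonempty
  have htrace : ContinuousOn (fun x => (eigproj (H x) j).trace) s :=
    continuous_id.matrix_trace.comp_continuousOn hP
  have hnat : Set.MapsTo (fun x => (eigproj (H x) j).trace) s (Set.range (Nat.cast : ℕ → ℝ)) :=
    fun x hx => ⟨_, (trace_eigproj (hsymm x hx) j).symm⟩
  exact ⟨_, fun x hx => hs.isPreconnected.constant_of_mapsTo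
    Nat.isUniformEmbedding_coe_real.isEmbedding.isDiscrete_range htrace hnat hx hx₀⟩

theorem constMultAt_of_trace_eq {V : Type*} [TopologicalSpace V] {m : ℕ}
    {H : V → Matrix (Fin m) (Fin m) ℝ} {j : Fin m} {s : Set V} {d : ℝ} (hs : IsOpen s)
    (hsymm : ∀ x ∈ s, (H x).IsSymm) (hd : ∀ x ∈ s, (eigproj (H x) j).trace = d) {x : V}
    (hx : x ∈ s) : ConstMultAt H j x := by
  filter_upwards [hs.mem_nhds hx] with y hy using ⟨hsymm y hy, (hd y hy).trans (hd x hx).symm⟩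

theorem contDiffOn_eigval {V : Type*} [NormedAddCommGroup V] [NormedSpace ℝ V]
    [FiniteDimensional ℝ V] {m : ℕ} {H : V → Matrix (Fin m) (Fin m) ℝ} {j : Fin m} {s : Set V}
    (hs : IsOpen s) (hH : ContDiffOn ℝ 1 H s) (h : ∀ x ∈ s, ConstMultAt H j x) :
    ContDiffOn ℝ 1 (fun x => eigval (H x) j) s := by
  have hdiff {x : V} (hx : x ∈ s) : DifferentiableAt ℝ H x :=
    (hH.differentiableOn one_ne_zero).differentiableAt (hs.mem_nhds hx)
  have hP : ContinuousOn (fun x => eigproj (H x) j) s := fun x hx =>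
    ((h x hx).continuousAt_eigproj (hdiff hx).continuousAt).continuousWithinAt
  have htrace : ContinuousOn (fun x => (eigproj (H x) j).trace) s :=
    continuous_id.matrix_trace.comp_continuousOn hP
  have hinv : ContinuousOn (fun x => 1 / (eigproj (H x) j).trace) s :=
    continuousOn_const.div htrace fun x hx => (trace_eigproj_pos (h x hx).isSymm j).ne'
  rw [← zero_add (1 : WithTop ℕ∞), contDiffOn_succ_iff_fderiv_of_isOpen hs]
  refine ⟨fun x hx => ((h x hx).differentiableAt_eigval (hdiff hx)).differentiableWithinAt,
    by simp, contDiffOn_zero.2 (continuousOn_clm_apply.2 fun e => ?_)⟩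
  have hHe : ContinuousOn (fun x => lineDeriv ℝ H x e) s :=
    ((hH.continuousOn_fderiv_of_isOpen hs le_rfl).clm_apply continuousOn_const).congr
      fun x hx => (hdiff hx).lineDeriv_eq_fderiv
  refine (hinv.mul (continuous_id.matrix_trace.comp_continuousOn (hP.mul hHe))).congr
    fun x hx => ?_
  rw [← ((h x hx).differentiableAt_eigval (hdiff hx)).lineDeriv_eq_fderiv]
  exact (h x hx).lineDeriv_eigval_eq_trace (hdiff hx) e

variable {n m : ℕ} {Ω : Set (EuclideanSpace ℝ (Fin n))}
  {H : EuclideanSpace ℝ (Fin n) → Matrix (Fin m) (Fin m) ℝ} {j : Fin m}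

theorem exists_trace_eigproj_eq_of_mem_regConds (hΩ : IsConnected Ω)
    (hsymm : ∀ x ∈ Ω, (H x).IsSymm) (h : ∃ c ∈ regConds Ω H j, c) :
    ∃ d : ℝ, ∀ x ∈ Ω, (eigproj (H x) j).trace = d := by
  simp only [regConds, List.mem_cons, List.not_mem_nil, or_false, exists_eq_or_imp,
    exists_eq_left] at h
  rcases h with ⟨-, htr⟩ | ⟨-, htr⟩ | hdiff | hcont
  · exact htr
  · exact htr
  · exact exists_trace_eigproj_eq_of_continuousOn hΩ hsymm hdiff.continuousOn
  · exact exists_trace_eigproj_eq_of_continuousOn hΩ hsymm hcont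

theorem constMultAt_of_mem_regConds (hΩo : IsOpen Ω) (hΩc : IsConnected Ω)
    (hsymm : ∀ x ∈ Ω, (H x).IsSymm) (h : ∃ c ∈ regConds Ω H j, c) :
    ∀ x ∈ Ω, ConstMultAt H j x :=
  have ⟨_, hd⟩ := exists_trace_eigproj_eq_of_mem_regConds hΩc hsymm h
  fun _ hx => constMultAt_of_trace_eq hΩo hsymm hd hx

theorem regConds_tfae (hΩo : IsOpen Ω) (hΩc : IsConnected Ω) (hsymm : ∀ x ∈ Ω, (H x).IsSymm)
    (hH : ContDiffOn ℝ 1 H Ω) : (regConds Ω H j).TFAE := by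
  unfold regConds
  tfae_have 1 → 2 := fun h => ⟨h.1.differentiableOn one_ne_zero, h.2⟩
  tfae_have 2 → 3 := fun ⟨_, _, hd⟩ x hx =>
    have hHx := (hH.differentiableOn one_ne_zero).differentiableAt (hΩo.mem_nhds hx)
    ((constMultAt_of_trace_eq hΩo hsymm hd hx).hasFDerivAt_eigproj
      hHx).differentiableAt.differentiableWithinAt
  tfae_have 3 → 4 := fun h => h.continuousOn
  tfae_have 4 → 1 := fun h =>
    have ⟨d, hd⟩ := exists_trace_eigproj_eq_of_continuousOn hΩc hsymm h
    ⟨contDiffOn_eigval hΩo hH fun _ hx => constMultAt_of_trace_eq hΩo hsymm hd hx, d, hd⟩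
  tfae_finish

end Conditions

end EigReg

theorem theorem4p6 {n m : ℕ} (Ω : Set (EuclideanSpace ℝ (Fin n)))
    (hΩo : IsOpen Ω) (hΩc : IsConnected Ω)
    (H : EuclideanSpace ℝ (Fin n) → Matrix (Fin m) (Fin m) ℝ)
    (hH : ∀ x ∈ Ω, (H x).IsSymm) (j : Fin m)
    (lam : EuclideanSpace ℝ (Fin n) → ℝ) (hlam : lam = fun x => eigval (H x) j)
    (P A : EuclideanSpace ℝ (Fin n) → Matrix (Fin m) (Fin m) ℝ)
    (hP : P = fun x => eigproj (H x) j) (hA : A = fun x => pinv (H x) j) :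
    -- (A)
    (ContinuousOn H Ω →
      ContinuousOn lam Ω ∧
      ∀ α C : ℝ≥0, 0 < α → α ≤ 1 → HolderOnWith C α H Ω → HolderOnWith C α lam Ω) ∧
    -- (B)
    (ContDiffOn ℝ 1 H Ω →
      -- (i)
      (∀ d : ℝ, (∀ x ∈ Ω, (P x).trace = d) → ∀ x ∈ Ω, ∀ e,
        LineDifferentiableAt ℝ lam x e ∧
        lineDeriv ℝ lam x e • P x = P x * dirD e H x * P x ∧
        lineDeriv ℝ lam x e = 1 / d * (P x * dirD e H x).trace ∧
        ∀ ξ ∈ unitRange (P x),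
          lineDeriv ℝ lam x e = ξ ⬝ᵥ (dirD e H x *ᵥ ξ) ∧
          lineDeriv ℝ lam x e = ξ ⬝ᵥ (jacDeriv ξ H x *ᵥ e.ofLp)) ∧
      -- (ii)
      (regConds Ω H j).TFAE ∧
      ((∃ c ∈ regConds Ω H j, c) → ∀ x ∈ Ω,
        DifferentiableAt ℝ lam x ∧
        ‖gradient lam x‖ ≤ 1 / √(P x).trace *
          sSup ((fun e => ‖dirD e H x‖) '' Metric.sphere (0 : EuclideanSpace ℝ (Fin n)) 1) ∧
        (∀ ξ ∈ unitRange (P x), (gradient lam x).ofLp = ξ ᵥ* jacDeriv ξ H x) ∧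
        ∀ e, inner ℝ (gradient lam x) e = lineDeriv ℝ lam x e ∧
          lineDeriv ℝ lam x e = 1 / (P x).trace * (P x * dirD e H x).trace)) ∧
    -- (C)
    (ContDiffOn ℝ 2 H Ω →
      -- (i)
      (∀ a : EuclideanSpace ℝ (Fin n), ∀ d : ℝ, (∀ x ∈ Ω, (P x).trace = d) →
        (∀ x ∈ Ω, LineDifferentiableAt ℝ lam x a) ∧
        ∀ x ∈ Ω, ∀ b,
          LineDifferentiableAt ℝ (fun y => lineDeriv ℝ lam y a) x b ∧
          lineDeriv ℝ (fun y => lineDeriv ℝ lam y a) x b • P x =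
            P x * (dirD b (dirD a H) x + dirD a H x * A x * dirD b H x
              + dirD b H x * A x * dirD a H x) * P x ∧
          lineDeriv ℝ (fun y => lineDeriv ℝ lam y a) x b =
            1 / d * (P x * (dirD b (dirD a H) x
              + (2 : ℝ) • (dirD a H x * A x * dirD b H x))).trace ∧
          ∀ ξ ∈ unitRange (P x),
            lineDeriv ℝ (fun y => lineDeriv ℝ lam y a) x b =
              ξ ⬝ᵥ ((dirD b (dirD a H) x + (2 : ℝ) • (dirD a H x * A x * dirD b H x)) *ᵥ ξ) ∧
            lineDeriv ℝ (fun y => lineDeriv ℝ lam y a) x b =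
              a.ofLp ⬝ᵥ (hessForm H j ξ x *ᵥ b.ofLp)) ∧
      -- (ii)
      ((∃ c ∈ regConds Ω H j, c) → ∀ x ∈ Ω,
        DifferentiableAt ℝ lam x ∧
        DifferentiableAt ℝ (gradient lam) x ∧
        (∀ ξ ∈ unitRange (P x), jacobian (gradient lam) x = hessForm H j ξ x) ∧
        ∀ a b : EuclideanSpace ℝ (Fin n),
          LineDifferentiableAt ℝ (fun y => lineDeriv ℝ lam y a) x b ∧
          a.ofLp ⬝ᵥ (jacobian (gradient lam) x *ᵥ b.ofLp) =
            lineDeriv ℝ (fun y => lineDeriv ℝ lam y a) x b ∧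
          lineDeriv ℝ (fun y => lineDeriv ℝ lam y a) x b =
            1 / (P x).trace * (P x * (dirD b (dirD a H) x
              + (2 : ℝ) • (dirD a H x * A x * dirD b H x))).trace)) := by
  subst hlam hP hA
  refine ⟨fun hC => ⟨continuousOn_eigval hH hC j, fun α C _ _ hα => holderOnWith_eigval hH hα j⟩,
    fun hC => ⟨fun d hd x hx e => ?_, regConds_tfae hΩo hΩc hH hC, fun hc x hx => ?_⟩,
    fun hC => ⟨fun a d hd => ⟨fun x hx => ?_, fun x hx b => ?_⟩, fun hc x hx => ?_⟩⟩
  all_goals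
    have hHx := hC.contDiffAt (hΩo.mem_nhds hx)
    have hHx₁ := hHx.differentiableAt (by simp)
    have h : ConstMultAt H j x := by
      first
      | exact constMultAt_of_trace_eq hΩo hH hd hx
      | exact constMultAt_of_mem_regConds hΩo hΩc hH hc x hx
    have hdiff := h.differentiableAt_eigval hHx₁
  · obtain rfl := hd x hx
    exact ⟨hdiff.lineDifferentiableAt, h.lineDeriv_eigval_smul hHx₁ e,
      h.lineDeriv_eigval_eq_trace hHx₁ e, fun ξ hξ => ⟨h.lineDeriv_eigval_eq_dotProduct hHx₁ hξ e,
        h.lineDeriv_eigval_eq_dotProduct_jacDeriv hHx₁ hξ e⟩⟩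
  · exact ⟨hdiff, h.norm_gradient_eigval_le hHx₁, fun ξ => h.gradient_eigval_eq_vecMul hHx₁,
      fun e => ⟨inner_gradient hdiff e, h.lineDeriv_eigval_eq_trace hHx₁ e⟩⟩
  · exact hdiff.lineDifferentiableAt
  · obtain rfl := hd x hx
    exact ⟨(h.differentiableAt_lineDeriv_eigval hHx a).lineDifferentiableAt,
      h.lineDeriv_lineDeriv_eigval_smul hHx a b, h.lineDeriv_lineDeriv_eigval_eq_trace hHx a b,
      fun ξ hξ => ⟨h.lineDeriv_lineDeriv_eigval_eq_dotProduct hHx hξ a b,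
        h.lineDeriv_lineDeriv_eigval_eq_hessForm hHx hξ a b⟩⟩
  · exact ⟨hdiff, h.differentiableAt_gradient_eigval hHx, fun ξ => h.jacobian_gradient_eigval hHx,
      fun a b => ⟨(h.differentiableAt_lineDeriv_eigval hHx a).lineDifferentiableAt,
        h.dotProduct_jacobian_gradient_eigval_mulVec hHx a b,
        h.lineDeriv_lineDeriv_eigval_eq_trace hHx a b⟩⟩
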